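/- **Theorem.** Let $n\ge 2$ be fixed, and for every $m\in\mathbb N$ let $p=p(m)\in\mathbb N$, where $p\to\infty$ and $m/p\to c\in(0,\infty)$ as $m\to\infty$. Let $\mathbf A_m$ be deterministic real $m\times p$ matrices with non-negative entries such that $\frac1{mp}\operatorname{tr}(\mathbf A_m\mathbf A_m^\top)$ is bounded uniformly in $m$, and let $\mathbf\Sigma_m$ be deterministic symmetric positive semidefinite $m\times m$ matrices such that $\frac1m\operatorname{tr}(\mathbf\Sigma_m)$ is bounded uniformly in $m$; write $\mathbf\Sigma_m^{1/2}$ for the symmetric positive semidefinite square root of $\mathbf\Sigma_m$. On one probability space, let $\mathbf E_m^1,\dots,\mathbf E_m^n$ be random $m\times p$ matrices such that for each $m$ all the entries of these $n$ matrices together are i.i.d. with mean $0$ and variance $1$, and such that for some $\varepsilon>0$ their absolute moments of order $4+\varepsilon$ are finite and bounded uniformly in $m$ (for instance, because the law of the entries does not depend on $m$). Nothing is assumed about the joint law of the noise matrices for different $m$. Put $$\tilde{\mathbf A}_m^k=\mathbf A_m+\mathbf\Sigma_m^{1/2}\mathbf E_m^k\quad(k=1,\dots,n),\qquad \bar{\mathbf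 A}_m=\frac1n\sum_{k=1}^n\tilde{\mathbf A}_m^k,$$ and let $\mathbf U_m$ be the $m\times p$ matrix all of whose entries are $1$. Then, almost surely, as $m\to\infty$, $$\Big|\tfrac1{mp}\operatorname{tr}(\bar{\mathbf A}_m\mathbf U_m^\top)-\tfrac1{mp}\operatorname{tr}(\mathbf A_m\mathbf U_m^\top)\Big|\to0,$$ $$\Big|\tfrac1{mp}\operatorname{tr}(\bar{\mathbf A}_m\mathbf A_m^\top)-\tfrac1{mp}\operatorname{tr}(\mathbf A_m\mathbf A_m^\top)\Big|\to0,$$ $$\Big|\tfrac1{mp}\operatorname{tr}(\bar{\mathbf A}_m\bar{\mathbf A}_m^\top)-\tfrac1{mp}\operatorname{tr}(\mathbf A_m\mathbf A_m^\top)-\tfrac1{nm}\operatorname{tr}(\mathbf\Sigma_m)\Big|\to0.$$ -/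

import Mathlib

open MeasureTheory ProbabilityTheory Filter Topology

noncomputable section

namespace ColumnCorrelated

open scoped MatrixOrder in
/-- The symmetric positive semidefinite square root of a positive semidefinite real matrix. -/
def matSqrt {m : ℕ} (S : Matrix (Fin m) (Fin m) ℝ) : Matrix (Fin m) (Fin m) ℝ :=
  CFC.sqrt S

/-- The `m × p` target matrix all of whose entries are one. -/
def allOnes (m p : ℕ) : Matrix (Fin m) (Fin p) ℝ :=
  Matrix.of fun _ _ => 1

/-- An observation of `A` under column-correlated noise: `A + S ^ (1/2) * E`. -/
def observation {m p : ℕ} (A : Matrix (Fin m) (Fin p) ℝ) (S : Matrix (Fin m) (Fin m) ℝ)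
    (E : Matrix (Fin m) (Fin p) ℝ) : Matrix (Fin m) (Fin p) ℝ :=
  A + matSqrt S * E

/-- The average of the `n` observations of `A` with noise matrices `E 0, …, E (n - 1)`. -/
def sampleMean {n m p : ℕ} (A : Matrix (Fin m) (Fin p) ℝ) (S : Matrix (Fin m) (Fin m) ℝ)
    (E : Fin n → Matrix (Fin m) (Fin p) ℝ) : Matrix (Fin m) (Fin p) ℝ :=
  (1 / (n : ℝ)) • ∑ k, observation A S (E k)

/-- The deterministic sequence `x` is an asymptotic deterministic equivalent of the sequence of
random variables `X`: `|X m - x m| → 0` almost surely as `m → ∞`. -/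
def AsympDetEquiv {Ω : Type*} [MeasurableSpace Ω] (P : Measure Ω)
    (X : ℕ → Ω → ℝ) (x : ℕ → ℝ) : Prop :=
  ∀ᵐ ω ∂P, Tendsto (fun m => |X m ω - x m|) atTop (𝓝 0)

/-- The entries of the `n` random `m × p` matrices `E 0, …, E (n - 1)` are altogether independent
and identically distributed, with mean zero and variance one. -/
structure IsStandardNoise {Ω : Type*} [MeasurableSpace Ω] (P : Measure Ω) {n m p : ℕ}
    (E : Fin n → Ω → Matrix (Fin m) (Fin p) ℝ) : Prop where
  measurable : ∀ k i j, Measurable fun ω => E k ω i j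
  indep : iIndepFun (fun (t : Fin n × Fin m × Fin p) ω => E t.1 ω t.2.1 t.2.2) P
  identDistrib : ∀ k i j k' i' j',
    IdentDistrib (fun ω => E k ω i j) (fun ω => E k' ω i' j') P P
  mean : ∀ k i j, ∫ ω, E k ω i j ∂P = 0
  variance : ∀ k i j, Var[fun ω => E k ω i j; P] = 1

end ColumnCorrelated

end

/-! ### A Marcinkiewicz–Zygmund inequality -/

/-! The sample mean is `A + N`, where `N` is the averaged coloured noise. The first two deviations
are linear forms `tr(N Mᵀ)/(mp)` in the noise entries. Expanding the square, the third is twice such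
a form with `M = A`, plus the centred quadratic form `tr(N Nᵀ)/(mp) - tr(S)/(nm)`.

Everything rests on a Marcinkiewicz–Zygmund bound, `lpNorm_sum_sq_le`: for `r > 2`, the squared
`L^r` norm of a sum of independent centred variables is at most a constant times the sum of their
squared norms. With Cauchy–Schwarz it bounds the squared `L^r` norm of the linear forms by a
constant times `1/p`. The quadratic form is a sum over the `p` independent columns. The triangle
inequality inside a column gives a term of size `tr S`, and the bound applied across columns in
`L^(r/2)` again leaves `1/p`. This is where moments of order `r = 4 + ε` are needed: `r/2` must
exceed `2`.

Since `p` grows like `m`, a squared `L^q` norm of order `1/m` with `q > 2` makes the `q`-th moments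
summable. That forces almost sure convergence whatever the joint law across different `m`. -/

/-- The linear term is kept exact so that it vanishes on integration. For `|r z| ≤ 1`, compare with
`exp (r z)` and its second-order expansion. Otherwise `|1 + z| ≤ (r + 1) |z|`, and a negative `r z`
is absorbed by `r² z²`. -/
theorem abs_one_add_rpow_le {r : ℝ} (hr : 2 < r) (z : ℝ) :
    |1 + z| ^ r ≤ 1 + r * z + (r + 1) ^ r * (z ^ 2 + |z| ^ r) := by
  have hC : r ^ 2 ≤ (r + 1) ^ r := by
    calc r ^ 2 ≤ (r + 1) ^ 2 := by gcongr; linarith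
      _ = (r + 1) ^ (2 : ℝ) := by norm_cast
      _ ≤ (r + 1) ^ r := Real.rpow_le_rpow_of_exponent_le (by linarith) hr.le
  have hz : 0 ≤ |z| ^ r := by positivity
  have hsq : r ^ 2 * z ^ 2 ≤ (r + 1) ^ r * z ^ 2 := by gcongr
  have hC0 : 0 ≤ (r + 1) ^ r := by positivity
  rcases le_or_gt |r * z| 1 with h | h
  · have hz1 : |z| ≤ 1 := by
      rw [abs_mul, abs_of_pos (by linarith)] at h
      nlinarith [abs_nonneg z]
    have hnn : 0 ≤ 1 + z := by linarith [(abs_le.1 hz1).1]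
    have h1 : |1 + z| ^ r ≤ Real.exp (r * z) := by
      rw [abs_of_nonneg hnn, mul_comm r z, Real.exp_mul]
      exact Real.rpow_le_rpow hnn (by linarith [Real.add_one_le_exp z]) (by linarith)
    have h2 := (abs_le.1 (Real.abs_exp_sub_one_sub_id_le h)).2
    nlinarith [mul_nonneg hC0 hz]
  · have h1 : |1 + z| ≤ (r + 1) * |z| := by
      rw [abs_mul, abs_of_pos (by linarith)] at h
      linarith [abs_add_le 1 z, abs_one (α := ℝ)]
    have h2 : |1 + z| ^ r ≤ (r + 1) ^ r * |z| ^ r := by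
      rw [← Real.mul_rpow (by linarith) (abs_nonneg z)]
      exact Real.rpow_le_rpow (abs_nonneg _) h1 (by linarith)
    have h3 : |r * z| ≤ r ^ 2 * z ^ 2 := by
      rw [← mul_pow, ← sq_abs]; nlinarith
    linarith [neg_abs_le (r * z)]

/-- Homogeneous form of the previous bound: take `z = y / x` and multiply by `|x| ^ r`. -/
theorem abs_add_rpow_le {r : ℝ} (hr : 2 < r) (x y : ℝ) :
    |x + y| ^ r ≤ |x| ^ r + r * (|x| ^ (r - 2) * x * y) +
      (r + 1) ^ r * (|x| ^ (r - 2) * y ^ 2 + |y| ^ r) := by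
  rcases eq_or_ne x 0 with rfl | hx
  · have h1 : (1 : ℝ) ≤ (r + 1) ^ r := Real.one_le_rpow (by linarith) (by linarith)
    have : 0 ≤ |y| ^ r := by positivity
    simp only [zero_add, abs_zero]
    rw [Real.zero_rpow (by linarith), Real.zero_rpow (by linarith)]
    nlinarith
  · have hx' : 0 < |x| := abs_pos.2 hx
    have h := mul_le_mul_of_nonneg_left (abs_one_add_rpow_le hr (y / x))
      (Real.rpow_nonneg hx'.le r)
    have e1 : |x| ^ r * |1 + y / x| ^ r = |x + y| ^ r := by
      rw [← Real.mul_rpow hx'.le (abs_nonneg _), ← abs_mul]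
      congr 2; field_simp
    have e2 : |x| ^ r * |y / x| ^ r = |y| ^ r := by
      rw [← Real.mul_rpow hx'.le (abs_nonneg _), ← abs_mul]
      congr 2; field_simp
    have e3 : |x| ^ r = |x| ^ (r - 2) * x ^ 2 := by
      rw [← sq_abs x, ← Real.rpow_natCast, ← Real.rpow_add hx']; norm_num
    have e4 : |x| ^ r * (y / x) = |x| ^ (r - 2) * x * y := by
      rw [e3]; field_simp
    have e5 : |x| ^ r * (y / x) ^ 2 = |x| ^ (r - 2) * y ^ 2 := by
      rw [e3]; field_simp
    calc |x + y| ^ r ≤ _ := e1.symm.trans_le h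
      _ = |x| ^ r + r * (|x| ^ r * (y / x)) +
          (r + 1) ^ r * (|x| ^ r * (y / x) ^ 2 + |x| ^ r * |y / x| ^ r) := by ring
      _ = _ := by rw [e4, e5, e2]

/-- Turns a recursion for `r`-th moments into an additive one for squared norms, with `ρ = r / 2`.
Put `T = s + 2 C t` and write `T ^ ρ = T ^ (ρ - 1) * (s + C t + C t)`; both `s` and `t` are at most
`T`. -/
theorem rpow_add_le_rpow_add_mul {ρ C s t : ℝ} (hρ : 1 < ρ) (hC : 1 ≤ C) (hs : 0 ≤ s)
    (ht : 0 ≤ t) :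
    s ^ ρ + C * (s ^ (ρ - 1) * t + t ^ ρ) ≤ (s + 2 * C * t) ^ ρ := by
  have key : ∀ u : ℝ, 0 ≤ u → u ^ ρ = u ^ (ρ - 1) * u := fun u hu => by
    rw [← Real.rpow_add_one' hu (by linarith)]; ring_nf
  have hCt : 0 ≤ 2 * C * t := by positivity
  have h1 : s ^ (ρ - 1) ≤ (s + 2 * C * t) ^ (ρ - 1) :=
    Real.rpow_le_rpow hs (by linarith) (by linarith)
  have h2 : t ^ (ρ - 1) ≤ (s + 2 * C * t) ^ (ρ - 1) :=
    Real.rpow_le_rpow ht (by nlinarith) (by linarith)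
  rw [key s hs, key t ht, key _ (add_nonneg hs hCt)]
  have hCt' : 0 ≤ C * t := by positivity
  nlinarith [mul_le_mul_of_nonneg_right h1 hs, mul_le_mul_of_nonneg_right h1 hCt',
    mul_le_mul_of_nonneg_right h2 hCt']

/-! ### Moment bounds for sums of independent centred variables -/

section Moments

variable {Ω : Type*} [MeasurableSpace Ω] {P : Measure Ω}

theorem integral_abs_rpow_eq_lpNorm {X : Ω → ℝ} {r : ℝ} (hr : 0 < r)
    (hX : AEStronglyMeasurable X P) :
    ∫ ω, |X ω| ^ r ∂P = lpNorm X (ENNReal.ofReal r) P ^ r := by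
  rw [lpNorm_eq_integral_norm_rpow_toReal (by simpa using hr) ENNReal.ofReal_ne_top hX,
    ENNReal.toReal_ofReal hr.le, Real.rpow_inv_rpow _ hr.ne']
  · rfl
  · positivity

theorem integrable_abs_rpow {X : Ω → ℝ} {r : ℝ} (hr : 0 < r)
    (hX : MemLp X (ENNReal.ofReal r) P) : Integrable (fun ω => |X ω| ^ r) P := by
  have := hX.integrable_norm_rpow (by simpa using hr) ENNReal.ofReal_ne_top
  simpa [ENNReal.toReal_ofReal hr.le] using this

theorem lpNorm_mono_exponent [IsProbabilityMeasure P] {X : Ω → ℝ} {p q : ENNReal} (hpq : p ≤ q)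
    (hX : MemLp X q P) : lpNorm X p P ≤ lpNorm X q P := by
  rw [← toReal_eLpNorm hX.1, ← toReal_eLpNorm hX.1]
  exact ENNReal.toReal_mono hX.eLpNorm_ne_top (eLpNorm_le_eLpNorm_of_exponent_le hpq hX.1)

theorem integral_abs_rpow_le [IsProbabilityMeasure P] {X : Ω → ℝ} {a r : ℝ} (ha : 0 < a)
    (har : a ≤ r) (hX : MemLp X (ENNReal.ofReal r) P) :
    ∫ ω, |X ω| ^ a ∂P ≤ lpNorm X (ENNReal.ofReal r) P ^ a := by
  rw [integral_abs_rpow_eq_lpNorm ha hX.1]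
  exact Real.rpow_le_rpow lpNorm_nonneg
    (lpNorm_mono_exponent (ENNReal.ofReal_le_ofReal har) hX) ha.le

/-- Integrate `abs_add_rpow_le`: independence and centring of `Y` kill the linear term, and
independence factors the mixed one. The slack `s` lets an induction hypothesis be inserted directly.
-/
theorem lpNorm_add_sq_le [IsProbabilityMeasure P] {X Y : Ω → ℝ} {r s : ℝ} (hr : 2 < r)
    (hX : MemLp X (ENNReal.ofReal r) P) (hY : MemLp Y (ENNReal.ofReal r) P)
    (hXY : IndepFun X Y P) (hY0 : ∫ ω, Y ω ∂P = 0)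
    (hs : lpNorm X (ENNReal.ofReal r) P ^ 2 ≤ s) :
    lpNorm (X + Y) (ENNReal.ofReal r) P ^ 2 ≤
      s + 2 * (r + 1) ^ r * lpNorm Y (ENNReal.ofReal r) P ^ 2 := by
  have hr0 : 0 < r := by linarith
  set a := lpNorm X (ENNReal.ofReal r) P with ha_def
  set b := lpNorm Y (ENNReal.ofReal r) P with hb_def
  have ha : 0 ≤ a := lpNorm_nonneg
  have hb : 0 ≤ b := lpNorm_nonneg
  have hle : ∀ {t : ℝ}, t ≤ r → ENNReal.ofReal t ≤ ENNReal.ofReal r :=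
    fun h => ENNReal.ofReal_le_ofReal h
  have iX := integrable_abs_rpow hr0 hX
  have iY := integrable_abs_rpow hr0 hY
  have iX2 : Integrable (fun ω => |X ω| ^ (r - 2)) P :=
    integrable_abs_rpow (by linarith) (hX.mono_exponent (hle (by linarith)))
  have iX1 : Integrable (fun ω => |X ω| ^ (r - 2) * X ω) P := by
    refine (integrable_abs_rpow (r := r - 1) (by linarith)
      (hX.mono_exponent (hle (by linarith)))).mono
      (iX2.1.mul hX.1) (Eventually.of_forall fun ω => le_of_eq ?_)
    have h0 : ∀ t : ℝ, |(|X ω| ^ t)| = |X ω| ^ t := fun t => abs_of_nonneg (by positivity)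
    rw [norm_mul, Real.norm_eq_abs, Real.norm_eq_abs, Real.norm_eq_abs, h0, h0,
      ← Real.rpow_add_one' (abs_nonneg _) (by linarith)]
    ring_nf
  have iY1 : Integrable Y P :=
    hY.integrable (by simpa using hle (t := 1) (by linarith))
  have iY2 : Integrable (fun ω => Y ω ^ 2) P := by
    have := integrable_abs_rpow (r := 2) (by norm_num) (hY.mono_exponent (hle (t := 2) (by linarith)))
    simpa using this
  have hind1 : IndepFun (fun ω => |X ω| ^ (r - 2) * X ω) Y P :=
    hXY.comp (φ := fun x : ℝ => |x| ^ (r - 2) * x) (ψ := id) (by fun_prop) measurable_id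
  have hind2 : IndepFun (fun ω => |X ω| ^ (r - 2)) (fun ω => Y ω ^ 2) P :=
    hXY.comp (φ := fun x : ℝ => |x| ^ (r - 2)) (ψ := fun y : ℝ => y ^ 2) (by fun_prop) (by fun_prop)
  have j1 : Integrable (fun ω => |X ω| ^ (r - 2) * X ω * Y ω) P := hind1.integrable_mul iX1 iY1
  have j2 : Integrable (fun ω => |X ω| ^ (r - 2) * Y ω ^ 2) P := hind2.integrable_mul iX2 iY2
  have m1 : ∫ ω, |X ω| ^ (r - 2) * X ω * Y ω ∂P = 0 := by
    rw [hind1.integral_fun_mul_eq_mul_integral iX1.1 iY1.1, hY0, mul_zero]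
  have m2 : ∫ ω, |X ω| ^ (r - 2) * Y ω ^ 2 ∂P ≤ a ^ (r - 2) * b ^ 2 := by
    rw [hind2.integral_fun_mul_eq_mul_integral iX2.1 iY2.1]
    have h1 := integral_abs_rpow_le (a := r - 2) (by linarith) (by linarith) hX
    have h2 := integral_abs_rpow_le (a := 2) (by norm_num) hr.le hY
    simp only [Real.rpow_two, sq_abs] at h2
    exact mul_le_mul h1 h2 (by positivity) (by positivity)
  have hmain : ∫ ω, |X ω + Y ω| ^ r ∂P ≤
      a ^ r + (r + 1) ^ r * (a ^ (r - 2) * b ^ 2 + b ^ r) := by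
    calc ∫ ω, |X ω + Y ω| ^ r ∂P ≤ ∫ ω, (|X ω| ^ r + r * (|X ω| ^ (r - 2) * X ω * Y ω) +
          (r + 1) ^ r * (|X ω| ^ (r - 2) * Y ω ^ 2 + |Y ω| ^ r)) ∂P :=
        integral_mono (integrable_abs_rpow hr0 (hX.add hY))
          ((iX.add (j1.const_mul r)).add ((j2.add iY).const_mul _))
          fun ω => abs_add_rpow_le hr _ _
      _ = ∫ ω, |X ω| ^ r ∂P + r * ∫ ω, |X ω| ^ (r - 2) * X ω * Y ω ∂P +
          (r + 1) ^ r * (∫ ω, |X ω| ^ (r - 2) * Y ω ^ 2 ∂P + ∫ ω, |Y ω| ^ r ∂P) := by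
        rw [integral_add (f := fun ω => |X ω| ^ r + r * (|X ω| ^ (r - 2) * X ω * Y ω))
            (g := fun ω => (r + 1) ^ r * (|X ω| ^ (r - 2) * Y ω ^ 2 + |Y ω| ^ r))
            (iX.add (j1.const_mul r)) ((j2.add iY).const_mul _),
          integral_add iX (j1.const_mul r), integral_const_mul, integral_const_mul,
          integral_add j2 iY]
      _ ≤ _ := by
        rw [m1, mul_zero, add_zero, integral_abs_rpow_eq_lpNorm hr0 hX.1,
          integral_abs_rpow_eq_lpNorm hr0 hY.1]
        gcongr
  have conv : ∀ {u t : ℝ}, 0 ≤ u → u ^ t = (u ^ 2) ^ (t / 2) := fun {u t} hu => by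
    rw [← Real.rpow_natCast u 2, ← Real.rpow_mul hu]; congr 1; push_cast; ring
  have hs0 : 0 ≤ s := (sq_nonneg a).trans hs
  have hC : (1 : ℝ) ≤ (r + 1) ^ r := Real.one_le_rpow (by linarith) hr0.le
  have hfin : (lpNorm (X + Y) (ENNReal.ofReal r) P ^ 2) ^ (r / 2) ≤
      (s + 2 * (r + 1) ^ r * b ^ 2) ^ (r / 2) := by
    rw [← conv lpNorm_nonneg, ← integral_abs_rpow_eq_lpNorm hr0 (hX.add hY).1]
    refine (le_trans hmain ?_).trans
      (rpow_add_le_rpow_add_mul (by linarith) hC hs0 (sq_nonneg b))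
    rw [conv (t := r) ha, conv (t := r - 2) ha, conv (t := r) hb,
      show (r - 2) / 2 = r / 2 - 1 by ring]
    have : 0 ≤ r / 2 - 1 := by linarith
    gcongr
  exact (Real.rpow_le_rpow_iff (by positivity) (by positivity) (by linarith)).1 hfin

/-- Marcinkiewicz–Zygmund type inequality for sums of centred random variables, each of which is
independent of the sum of any of the others. -/
theorem lpNorm_sum_sq_le [IsProbabilityMeasure P] {ι : Type*} {X : ι → Ω → ℝ} {r : ℝ} (hr : 2 < r)
    (hX : ∀ i, MemLp (X i) (ENNReal.ofReal r) P) (hX0 : ∀ i, ∫ ω, X i ω ∂P = 0)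
    (hind : ∀ (s : Finset ι) (i : ι), i ∉ s → IndepFun (∑ j ∈ s, X j) (X i) P) (s : Finset ι) :
    lpNorm (∑ i ∈ s, X i) (ENNReal.ofReal r) P ^ 2 ≤
      2 * (r + 1) ^ r * ∑ i ∈ s, lpNorm (X i) (ENNReal.ofReal r) P ^ 2 := by
  classical
  induction s using Finset.induction_on with
  | empty => simp
  | insert i s hi ih =>
    rw [Finset.sum_insert hi, Finset.sum_insert hi, add_comm (X i), mul_add,
      add_comm (2 * (r + 1) ^ r * lpNorm (X i) _ P ^ 2)]
    exact lpNorm_add_sq_le hr (memLp_finsetSum' s fun j _ => hX j) (hX i) (hind s i hi) (hX0 i) ih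

end Moments

/-! ### Almost sure convergence from summable moments -/

section Convergence

variable {Ω : Type*} [MeasurableSpace Ω] {P : Measure Ω}

/-- By Tonelli the series of `|X m| ^ q` has finite expectation, so it converges almost surely and
its terms tend to `0`. -/
theorem ae_tendsto_zero_of_summable_integral {X : ℕ → Ω → ℝ} {q : ℝ} (hq : 0 < q)
    (hX : ∀ m, MemLp (X m) (ENNReal.ofReal q) P)
    (hs : Summable fun m => ∫ ω, |X m ω| ^ q ∂P) :
    ∀ᵐ ω ∂P, Tendsto (fun m => X m ω) atTop (𝓝 0) := by
  have hint := fun m => integrable_abs_rpow hq (hX m)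
  have hmeas : ∀ m, AEMeasurable (fun ω => ENNReal.ofReal (|X m ω| ^ q)) P :=
    fun m => (hint m).1.aemeasurable.ennreal_ofReal
  have hfin : ∫⁻ ω, ∑' m, ENNReal.ofReal (|X m ω| ^ q) ∂P ≠ ⊤ := by
    rw [lintegral_tsum hmeas]
    have : ∀ m, ∫⁻ ω, ENNReal.ofReal (|X m ω| ^ q) ∂P =
        ENNReal.ofReal (∫ ω, |X m ω| ^ q ∂P) := fun m =>
      (ofReal_integral_eq_lintegral_ofReal (hint m)
        (Eventually.of_forall fun ω => by positivity)).symm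
    simp_rw [this]
    exact hs.tsum_ofReal_ne_top
  filter_upwards [ae_lt_top' (AEMeasurable.tsum hmeas) hfin] with ω hω
  have h0 := (ENNReal.tendsto_toReal ENNReal.zero_ne_top).comp
    (ENNReal.tendsto_atTop_zero_of_tsum_ne_top hω.ne)
  have h1 : Tendsto (fun m => |X m ω| ^ q) atTop (𝓝 0) := by
    refine h0.congr fun m => ?_
    exact ENNReal.toReal_ofReal (by positivity)
  have h2 := h1.rpow_const (p := q⁻¹) (Or.inr (by positivity))
  rw [Real.zero_rpow (by positivity)] at h2
  rw [tendsto_zero_iff_abs_tendsto_zero]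
  exact h2.congr fun m => Real.rpow_rpow_inv (abs_nonneg _) hq.ne'

theorem ae_tendsto_zero_of_lpNorm_sq_le {X : ℕ → Ω → ℝ} {q C : ℝ} (hq : 2 < q)
    (hX : ∀ m, MemLp (X m) (ENNReal.ofReal q) P)
    (hC : ∀ᶠ m : ℕ in atTop, lpNorm (X m) (ENNReal.ofReal q) P ^ 2 ≤ C / m) :
    ∀ᵐ ω ∂P, Tendsto (fun m => X m ω) atTop (𝓝 0) := by
  have hq0 : 0 < q := by linarith
  refine ae_tendsto_zero_of_summable_integral hq0 hX ?_
  -- The exponent `q / 2` exceeds `1`; `|C|` replaces `C`, whose sign is not assumed.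
  have hsum : Summable fun m : ℕ => |C| ^ (q / 2) * ((m : ℝ) ^ (q / 2))⁻¹ :=
    (Real.summable_nat_rpow_inv.2 (by linarith)).mul_left _
  refine hsum.of_norm_bounded_eventually_nat ?_
  filter_upwards [hC] with m hm
  rw [integral_abs_rpow_eq_lpNorm hq0 (hX m).1, Real.norm_of_nonneg (Real.rpow_nonneg lpNorm_nonneg _),
    ← div_eq_mul_inv, ← Real.div_rpow (abs_nonneg C) (Nat.cast_nonneg m)]
  calc lpNorm (X m) (ENNReal.ofReal q) P ^ q
      = (lpNorm (X m) (ENNReal.ofReal q) P ^ 2) ^ (q / 2) := by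
        rw [← Real.rpow_natCast, ← Real.rpow_mul lpNorm_nonneg]; congr 1; push_cast; ring
    _ ≤ (|C| / m) ^ (q / 2) := by
        refine Real.rpow_le_rpow (by positivity) (hm.trans ?_) (by linarith)
        gcongr
        exact le_abs_self C

end Convergence

/-! ### Linear and quadratic forms in independent entries -/

section Forms

variable {Ω : Type*} [MeasurableSpace Ω] {P : Measure Ω}

theorem memLp_ofReal_of_integrable_abs_rpow {X : Ω → ℝ} {r : ℝ} (hr : 0 < r)
    (hm : AEStronglyMeasurable X P) (hX : Integrable (fun ω => |X ω| ^ r) P) :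
    MemLp X (ENNReal.ofReal r) P := by
  rw [← integrable_norm_rpow_iff hm (by simpa using hr) ENNReal.ofReal_ne_top,
    ENNReal.toReal_ofReal hr.le]
  exact hX

theorem eLpNorm_sq {X : Ω → ℝ} {r : ℝ} (hr : 0 < r) :
    eLpNorm (fun ω => X ω ^ 2) (ENNReal.ofReal (r / 2)) P =
      eLpNorm X (ENNReal.ofReal r) P ^ 2 := by
  have h := eLpNorm_norm_rpow (p := ENNReal.ofReal (r / 2)) (μ := P) X (q := 2) (by norm_num)
  rw [← ENNReal.ofReal_mul (by linarith), div_mul_cancel₀ _ (by norm_num)] at h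
  simpa using h

theorem memLp_sq_half {X : Ω → ℝ} {r : ℝ} (hr : 0 < r) (hX : MemLp X (ENNReal.ofReal r) P) :
    MemLp (fun ω => X ω ^ 2) (ENNReal.ofReal (r / 2)) P := by
  refine ⟨hX.1.pow 2, ?_⟩
  rw [eLpNorm_sq hr]
  exact ENNReal.pow_lt_top hX.2

theorem lpNorm_sq {X : Ω → ℝ} {r : ℝ} (hr : 0 < r) (hX : AEStronglyMeasurable X P) :
    lpNorm (fun ω => X ω ^ 2) (ENNReal.ofReal (r / 2)) P =
      lpNorm X (ENNReal.ofReal r) P ^ 2 := by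
  rw [← toReal_eLpNorm hX, ← toReal_eLpNorm (f := fun ω => X ω ^ 2) (hX.pow 2), eLpNorm_sq hr, ENNReal.toReal_pow]

theorem lpNorm_finsetSum_le {ι : Type*} {X : ι → Ω → ℝ} {p : ENNReal} (hp : 1 ≤ p)
    (hX : ∀ i, MemLp (X i) p P) (s : Finset ι) :
    lpNorm (∑ i ∈ s, X i) p P ≤ ∑ i ∈ s, lpNorm (X i) p P := by
  classical
  induction s using Finset.induction_on with
  | empty => simp
  | insert i s hi ih =>
    rw [Finset.sum_insert hi, Finset.sum_insert hi]
    linarith [lpNorm_add_le (hX i) hp (g := ∑ i ∈ s, X i)]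

/-- The two sides read disjoint blocks of a jointly independent array. -/
theorem indepFun_sum_columns {α β : Type*} [Fintype α] {X : α → β → Ω → ℝ} (hm : ∀ i j, Measurable (X i j))
    (hind : iIndepFun (fun t : α × β => X t.1 t.2) P) {f : (α → ℝ) → ℝ} (hf : Measurable f)
    {s : Finset β} {j : β} (hj : j ∉ s) :
    IndepFun (∑ b ∈ s, fun ω => f fun i => X i b ω) (fun ω => f fun i => X i j ω) P := by
  classical
  have hdisj : Disjoint ((Finset.univ : Finset α) ×ˢ s) ((Finset.univ : Finset α) ×ˢ {j}) := by
    rw [Finset.disjoint_left]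
    rintro ⟨a, b⟩ h1 h2
    simp only [Finset.mem_product, Finset.mem_singleton, Finset.mem_univ, true_and] at h1 h2
    exact hj (h2 ▸ h1)
  have h := hind.indepFun_finset _ _ hdisj fun t => hm t.1 t.2
  have h' := h.comp
    (φ := fun x => ∑ b : s, f fun i => x ⟨(i, b.1), by simp⟩)
    (ψ := fun x => f fun i => x ⟨(i, j), by simp⟩)
    (Finset.measurable_fun_sum _ fun b _ => hf.comp
      (measurable_pi_lambda _ fun i => measurable_pi_apply _))
    (hf.comp (measurable_pi_lambda _ fun i => measurable_pi_apply _))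
  refine h'.congr (Eventually.of_forall fun ω => ?_) (Eventually.of_forall fun ω => rfl)
  simp only [Finset.sum_apply, Function.comp_apply]
  exact Finset.sum_coe_sort s fun b => f fun i => X i b ω

variable [IsProbabilityMeasure P]

theorem lpNorm_linear_form_sq_le {ι : Type*} [Fintype ι] {X : ι → Ω → ℝ} {r κ : ℝ} (hr : 2 < r)
    (hm : ∀ i, Measurable (X i)) (hind : iIndepFun X P)
    (hX : ∀ i, MemLp (X i) (ENNReal.ofReal r) P) (hX0 : ∀ i, ∫ ω, X i ω ∂P = 0)
    (hκ : ∀ i, lpNorm (X i) (ENNReal.ofReal r) P ≤ κ) (c : ι → ℝ) :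
    lpNorm (fun ω => ∑ i, c i * X i ω) (ENNReal.ofReal r) P ^ 2 ≤
      2 * (r + 1) ^ r * κ ^ 2 * ∑ i, c i ^ 2 := by
  have hfun : (fun ω => ∑ i, c i * X i ω) = ∑ i, (c i • X i) := by
    ext ω; simp
  have hind' : iIndepFun (fun i => c i • X i) P :=
    hind.comp (fun i x => c i * x) fun i => measurable_const_mul (c i)
  rw [hfun]
  refine (lpNorm_sum_sq_le hr (fun i => (hX i).const_smul (c i)) (fun i => ?_)
    (fun s i hi => hind'.indepFun_finsetSum_of_notMem (fun i => (hm i).const_smul (c i)) hi)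
    Finset.univ).trans ?_
  · simp [integral_const_mul, hX0]
  · rw [mul_assoc _ (κ ^ 2), Finset.mul_sum (f := fun i => c i ^ 2)]
    have hD : 0 ≤ 2 * (r + 1) ^ r := by
      have : 0 ≤ r + 1 := by linarith
      positivity
    refine mul_le_mul_of_nonneg_left (Finset.sum_le_sum fun i _ => ?_) hD
    rw [lpNorm_const_smul, mul_pow, mul_comm]
    have h1 : lpNorm (X i) (ENNReal.ofReal r) P ^ 2 ≤ κ ^ 2 :=
      pow_le_pow_left₀ lpNorm_nonneg (hκ i) 2
    have h2 : ((‖c i‖₊ : ℝ)) ^ 2 = c i ^ 2 := by simp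
    rw [h2]
    exact mul_le_mul_of_nonneg_right h1 (sq_nonneg _)

theorem integral_linear_form_sq {ι : Type*} [Fintype ι] {X : ι → Ω → ℝ}
    (hind : iIndepFun X P) (hX : ∀ i, MemLp (X i) 2 P) (hX0 : ∀ i, ∫ ω, X i ω ∂P = 0)
    (hX1 : ∀ i, Var[X i; P] = 1) (c : ι → ℝ) :
    ∫ ω, (∑ i, c i * X i ω) ^ 2 ∂P = ∑ i, c i ^ 2 := by
  have hfun : (fun ω => ∑ i, c i * X i ω) = ∑ i, (c i • X i) := by
    ext ω; simp
  have hind' : iIndepFun (fun i => c i • X i) P :=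
    hind.comp (fun i x => c i * x) fun i => measurable_const_mul (c i)
  have hmem : ∀ i, MemLp (c i • X i) 2 P := fun i => (hX i).const_smul (c i)
  have hint : ∀ i, Integrable (fun ω => c i * X i ω) P := fun i =>
    ((hX i).integrable (by norm_num)).const_mul (c i)
  have h0 : ∫ ω, (∑ i, c i * X i ω) ∂P = 0 := by
    rw [integral_finsetSum _ fun i _ => hint i]
    simp [integral_const_mul, hX0]
  have hvar := IndepFun.variance_sum (s := Finset.univ) (fun i _ => hmem i)
    (fun i _ j _ hij => hind'.indepFun hij)
  rw [← hfun, variance_of_integral_eq_zero ?_ h0] at hvar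
  · rw [hvar]
    refine Finset.sum_congr rfl fun i _ => ?_
    rw [variance_smul, hX1, mul_one]
  · rw [hfun]
    exact (memLp_finsetSum' _ fun i _ => hmem i).1.aemeasurable

/-- No cancellation is sought within a column: each square has `L^(r/2)` norm equal to a squared
`L^r` norm of a linear form, and these are added. The gain comes from independence across columns,
so `card β` appears to the first power only. -/
theorem lpNorm_quadratic_form_sq_le {α β ν : Type*} [Fintype α] [Fintype β] [Fintype ν]
    {X : α → β → Ω → ℝ} {r κ : ℝ} (hr : 4 < r)
    (hm : ∀ i j, Measurable (X i j)) (hind : iIndepFun (fun t : α × β => X t.1 t.2) P)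
    (hX : ∀ i j, MemLp (X i j) (ENNReal.ofReal r) P) (hX0 : ∀ i j, ∫ ω, X i j ω ∂P = 0)
    (hX1 : ∀ i j, Var[X i j; P] = 1)
    (hκ : ∀ i j, lpNorm (X i j) (ENNReal.ofReal r) P ≤ κ) (a : ν → α → ℝ) :
    MemLp (fun ω => ∑ j, ((∑ l, (∑ i, a l i * X i j ω) ^ 2) - ∑ l, ∑ i, a l i ^ 2))
      (ENNReal.ofReal (r / 2)) P ∧
    lpNorm (fun ω => ∑ j, ((∑ l, (∑ i, a l i * X i j ω) ^ 2) - ∑ l, ∑ i, a l i ^ 2))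
      (ENNReal.ofReal (r / 2)) P ^ 2 ≤
      2 * (r / 2 + 1) ^ (r / 2) * (Fintype.card β *
        ((2 * (r + 1) ^ r * κ ^ 2 + 1) * ∑ l, ∑ i, a l i ^ 2) ^ 2) := by
  have hr0 : 0 < r := by linarith
  have h1q : 1 ≤ ENNReal.ofReal (r / 2) := by
    rw [← ENNReal.ofReal_one]; exact ENNReal.ofReal_le_ofReal (by linarith)
  have h2r : (2 : ENNReal) ≤ ENNReal.ofReal r := by
    have := ENNReal.ofReal_le_ofReal (show (2 : ℝ) ≤ r by linarith)
    simpa using this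
  set τ := ∑ l, ∑ i, a l i ^ 2 with hτ
  have hτ0 : 0 ≤ τ := by positivity
  have hcol : ∀ j, iIndepFun (fun i => X i j) P := fun j =>
    hind.precomp (g := fun i => (i, j)) fun _ _ h => (Prod.ext_iff.1 h).1
  have hL : ∀ l j, MemLp (fun ω => ∑ i, a l i * X i j ω) (ENNReal.ofReal r) P := fun l j =>
    memLp_finsetSum _ fun i _ => (hX i j).const_mul (a l i)
  have hLsq := fun l j => memLp_sq_half hr0 (hL l j)
  set Y : β → Ω → ℝ := fun j ω => (∑ l, (∑ i, a l i * X i j ω) ^ 2) - τ with hY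
  have hsplit : ∀ j, Y j = (∑ l, fun ω => (∑ i, a l i * X i j ω) ^ 2) - fun _ => τ := fun j => by
    ext ω; simp [hY]
  have hZmem : ∀ j, MemLp (∑ l, fun ω => (∑ i, a l i * X i j ω) ^ 2) (ENNReal.ofReal (r / 2)) P :=
    fun j => memLp_finsetSum' _ fun l _ => hLsq l j
  have hYmem : ∀ j, MemLp (Y j) (ENNReal.ofReal (r / 2)) P := fun j => by
    rw [hsplit]
    exact (hZmem j).sub (memLp_const τ)
  have hYnorm : ∀ j, lpNorm (Y j) (ENNReal.ofReal (r / 2)) P ≤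
      (2 * (r + 1) ^ r * κ ^ 2 + 1) * τ := fun j => by
    rw [hsplit]
    refine (lpNorm_sub_le (hZmem j) h1q).trans ?_
    rw [add_mul, one_mul]
    refine add_le_add ((lpNorm_finsetSum_le (X := fun l ω => (∑ i, a l i * X i j ω) ^ 2) h1q
      (fun l => hLsq l j) Finset.univ).trans ?_) ?_
    · rw [hτ, Finset.mul_sum]
      refine Finset.sum_le_sum fun l _ => ?_
      rw [lpNorm_sq hr0 (hL l j).1]
      exact lpNorm_linear_form_sq_le (by linarith) (fun i => hm i j) (hcol j) (fun i => hX i j)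
        (fun i => hX0 i j) (fun i => hκ i j) (a l)
    · rw [lpNorm_const' (by simpa using hr0) ENNReal.ofReal_ne_top]
      simp [abs_of_nonneg hτ0]
  have hYint : ∀ j, ∫ ω, Y j ω ∂P = 0 := fun j => by
    have hi : ∀ l, Integrable (fun ω => (∑ i, a l i * X i j ω) ^ 2) P := fun l =>
      (hLsq l j).integrable h1q
    simp only [hY]
    rw [integral_sub (integrable_finsetSum _ fun l _ => hi l) (integrable_const τ),
      integral_finsetSum _ fun l _ => hi l]
    simp_rw [integral_linear_form_sq (hcol j) (fun i => (hX i j).mono_exponent h2r)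
      (fun i => hX0 i j) (fun i => hX1 i j)]
    simp [hτ]
  have hfun : (fun ω => ∑ j, Y j ω) = ∑ j, Y j := by ext ω; simp
  have hindY : ∀ (s : Finset β) (j : β), j ∉ s → IndepFun (∑ b ∈ s, Y b) (Y j) P :=
    fun s j hj => indepFun_sum_columns (f := fun x => (∑ l, (∑ i, a l i * x i) ^ 2) - τ) hm hind
      (by fun_prop) hj
  change MemLp (fun ω => ∑ j, Y j ω) _ P ∧ lpNorm (fun ω => ∑ j, Y j ω) _ P ^ 2 ≤ _
  rw [hfun]
  refine ⟨memLp_finsetSum' _ fun j _ => hYmem j,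
    (lpNorm_sum_sq_le (by linarith) hYmem hYint hindY Finset.univ).trans ?_⟩
  have hD : 0 ≤ 2 * (r / 2 + 1) ^ (r / 2) := by positivity
  refine mul_le_mul_of_nonneg_left ?_ hD
  refine (Finset.sum_le_sum fun j _ => pow_le_pow_left₀ lpNorm_nonneg (hYnorm j) 2).trans ?_
  simp

end Forms

/-! ### Algebra of the averaged noise -/

namespace ColumnCorrelated

theorem trace_mul_transpose_eq_sum {m p : ℕ} (A B : Matrix (Fin m) (Fin p) ℝ) :
    Matrix.trace (A * B.transpose) = ∑ l, ∑ j, A l j * B l j := by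
  simp [Matrix.trace, Matrix.mul_apply]

open scoped MatrixOrder in
theorem matSqrt_mul_transpose_self {m : ℕ} {S : Matrix (Fin m) (Fin m) ℝ} (hS : S.PosSemidef) :
    matSqrt S * (matSqrt S).transpose = S := by
  have h1 : (matSqrt S).transpose = matSqrt S := by
    have := (Matrix.nonneg_iff_posSemidef.1 (CFC.sqrt_nonneg S)).isHermitian
    simpa [Matrix.IsHermitian, matSqrt] using this
  rw [h1]
  exact CFC.sqrt_mul_sqrt_self S hS.nonneg

theorem sum_matSqrt_sq {m : ℕ} {S : Matrix (Fin m) (Fin m) ℝ} (hS : S.PosSemidef) :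
    ∑ l, ∑ i, matSqrt S l i ^ 2 = Matrix.trace S := by
  conv_rhs => rw [← matSqrt_mul_transpose_self hS, trace_mul_transpose_eq_sum]
  simp_rw [sq]

/-- The deviation of the sample mean from the true matrix: the averaged coloured noise. -/
noncomputable def meanNoise {n m p : ℕ} (S : Matrix (Fin m) (Fin m) ℝ)
    (E : Fin n → Matrix (Fin m) (Fin p) ℝ) : Matrix (Fin m) (Fin p) ℝ :=
  Matrix.of fun l j => ∑ t : Fin n × Fin m, matSqrt S l t.2 / n * E t.1 t.2 j

theorem sampleMean_eq_add_meanNoise {n m p : ℕ} (hn : n ≠ 0) (A : Matrix (Fin m) (Fin p) ℝ)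
    (S : Matrix (Fin m) (Fin m) ℝ) (E : Fin n → Matrix (Fin m) (Fin p) ℝ) :
    sampleMean A S E = A + meanNoise S E := by
  have hn' : (n : ℝ) ≠ 0 := Nat.cast_ne_zero.2 hn
  ext l j
  simp only [sampleMean, observation, meanNoise, Matrix.smul_apply, Matrix.sum_apply,
    Matrix.add_apply, Matrix.mul_apply, Matrix.of_apply, Finset.sum_add_distrib,
    Finset.sum_const, Finset.card_univ, Fintype.card_fin, nsmul_eq_mul, smul_eq_mul,
    Fintype.sum_prod_type, mul_add, Finset.mul_sum]
  congr 1
  · field_simp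
  · exact Finset.sum_congr rfl fun k _ => Finset.sum_congr rfl fun i _ => by ring

theorem sum_meanNoise_mul {n m p : ℕ} (S : Matrix (Fin m) (Fin m) ℝ)
    (E : Fin n → Matrix (Fin m) (Fin p) ℝ) (M : Matrix (Fin m) (Fin p) ℝ) (d : ℝ) :
    (∑ l, ∑ j, meanNoise S E l j * M l j) / d =
      ∑ t : Fin n × Fin m × Fin p,
        (∑ l, matSqrt S l t.2.1 * M l t.2.2) / (n * d) * E t.1 t.2.1 t.2.2 := by
  simp only [meanNoise, Matrix.of_apply, Fintype.sum_prod_type, Finset.sum_mul, Finset.sum_div]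
  have h1 : ∀ f : Fin m → Fin p → Fin n → Fin m → ℝ,
      ∑ l, ∑ j, ∑ k, ∑ i, f l j k i = ∑ k, ∑ i, ∑ j, ∑ l, f l j k i := fun f => by
    calc ∑ l, ∑ j, ∑ k, ∑ i, f l j k i = ∑ j, ∑ l, ∑ k, ∑ i, f l j k i := Finset.sum_comm
      _ = ∑ j, ∑ k, ∑ l, ∑ i, f l j k i :=
        Finset.sum_congr rfl fun _ _ => Finset.sum_comm
      _ = ∑ k, ∑ j, ∑ l, ∑ i, f l j k i := Finset.sum_comm
      _ = ∑ k, ∑ j, ∑ i, ∑ l, f l j k i :=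
        Finset.sum_congr rfl fun _ _ => Finset.sum_congr rfl fun _ _ => Finset.sum_comm
      _ = ∑ k, ∑ i, ∑ j, ∑ l, f l j k i :=
        Finset.sum_congr rfl fun _ _ => Finset.sum_comm
  rw [h1]
  refine Finset.sum_congr rfl fun k _ => Finset.sum_congr rfl fun i _ =>
    Finset.sum_congr rfl fun j _ => Finset.sum_congr rfl fun l _ => ?_
  simp only [div_eq_mul_inv, mul_inv]
  ring

/-- Cauchy–Schwarz in `l`, so that only the trace of `S` enters and no operator norm is needed. -/
theorem sum_matSqrt_mul_sq_le {m p : ℕ} {S : Matrix (Fin m) (Fin m) ℝ} (hS : S.PosSemidef)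
    (M : Matrix (Fin m) (Fin p) ℝ) :
    ∑ i, ∑ j, (∑ l, matSqrt S l i * M l j) ^ 2 ≤ Matrix.trace S * ∑ l, ∑ j, M l j ^ 2 := by
  calc ∑ i, ∑ j, (∑ l, matSqrt S l i * M l j) ^ 2
      ≤ ∑ i, ∑ j, (∑ l, matSqrt S l i ^ 2) * ∑ l, M l j ^ 2 :=
        Finset.sum_le_sum fun i _ => Finset.sum_le_sum fun j _ =>
          Finset.sum_mul_sq_le_sq_mul_sq _ _ _
    _ = (∑ i, ∑ l, matSqrt S l i ^ 2) * ∑ j, ∑ l, M l j ^ 2 := by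
        rw [Finset.sum_mul_sum]
    _ = _ := by
        rw [Finset.sum_comm, sum_matSqrt_sq hS, Finset.sum_comm (f := fun j l => M l j ^ 2)]

/-! ### Norm bounds for the averaged noise -/

section Noise

variable {Ω : Type*} [MeasurableSpace Ω] {P : Measure Ω} [IsProbabilityMeasure P]

theorem lpNorm_meanNoise_mul_sq_le {n m p : ℕ} (hn : n ≠ 0)
    {S : Matrix (Fin m) (Fin m) ℝ} (hS : S.PosSemidef)
    {E : Fin n → Ω → Matrix (Fin m) (Fin p) ℝ} (hE : IsStandardNoise P E) {r κ : ℝ} (hr : 2 < r)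
    (hmem : ∀ k i j, MemLp (fun ω => E k ω i j) (ENNReal.ofReal r) P)
    (hκ : ∀ k i j, lpNorm (fun ω => E k ω i j) (ENNReal.ofReal r) P ≤ κ)
    (M : Matrix (Fin m) (Fin p) ℝ) (d : ℝ) :
    MemLp (fun ω => (∑ l, ∑ j, meanNoise S (fun k => E k ω) l j * M l j) / d)
      (ENNReal.ofReal r) P ∧
    lpNorm (fun ω => (∑ l, ∑ j, meanNoise S (fun k => E k ω) l j * M l j) / d)
      (ENNReal.ofReal r) P ^ 2 ≤
      2 * (r + 1) ^ r * κ ^ 2 * (Matrix.trace S * (∑ l, ∑ j, M l j ^ 2) / d ^ 2) := by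
  simp_rw [sum_meanNoise_mul]
  refine ⟨memLp_finsetSum _ fun t _ => (hmem t.1 t.2.1 t.2.2).const_mul _,
    (lpNorm_linear_form_sq_le (X := fun (t : Fin n × Fin m × Fin p) ω => E t.1 ω t.2.1 t.2.2) hr
    (fun t => hE.measurable _ _ _) hE.indep (fun t => hmem _ _ _) (fun t => hE.mean _ _ _)
    (fun t => hκ _ _ _) _).trans ?_⟩
  have hD : 0 ≤ 2 * (r + 1) ^ r * κ ^ 2 := by
    have : 0 ≤ r + 1 := by linarith
    positivity
  refine mul_le_mul_of_nonneg_left ?_ hD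
  have hn1 : (1 : ℝ) ≤ n := by exact_mod_cast Nat.one_le_iff_ne_zero.2 hn
  have hB := sum_matSqrt_mul_sq_le hS M
  have hB0 : 0 ≤ ∑ i, ∑ j, (∑ l, matSqrt S l i * M l j) ^ 2 := by positivity
  have heq : ∑ t : Fin n × Fin m × Fin p,
      ((∑ l, matSqrt S l t.2.1 * M l t.2.2) / (n * d)) ^ 2 =
      (∑ i, ∑ j, (∑ l, matSqrt S l i * M l j) ^ 2) / d ^ 2 / n := by
    simp only [Fintype.sum_prod_type, Finset.sum_const, Finset.card_univ, Fintype.card_fin,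
      nsmul_eq_mul, div_pow, ← Finset.sum_div]
    field_simp
  rw [heq]
  -- The factor `1 / n` gained by averaging is not needed and is dropped.
  exact (div_le_self (by positivity) hn1).trans (by gcongr)

theorem lpNorm_meanNoise_sq_sq_le {n m p : ℕ} (hn : n ≠ 0)
    {S : Matrix (Fin m) (Fin m) ℝ} (hS : S.PosSemidef)
    {E : Fin n → Ω → Matrix (Fin m) (Fin p) ℝ} (hE : IsStandardNoise P E) {r κ : ℝ} (hr : 4 < r)
    (hmem : ∀ k i j, MemLp (fun ω => E k ω i j) (ENNReal.ofReal r) P)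
    (hκ : ∀ k i j, lpNorm (fun ω => E k ω i j) (ENNReal.ofReal r) P ≤ κ) (d : ℝ) :
    MemLp (fun ω => ((∑ l, ∑ j, meanNoise S (fun k => E k ω) l j ^ 2) -
      p * (Matrix.trace S / n)) / d) (ENNReal.ofReal (r / 2)) P ∧
    lpNorm (fun ω => ((∑ l, ∑ j, meanNoise S (fun k => E k ω) l j ^ 2) -
      p * (Matrix.trace S / n)) / d) (ENNReal.ofReal (r / 2)) P ^ 2 ≤
      2 * (r / 2 + 1) ^ (r / 2) * (2 * (r + 1) ^ r * κ ^ 2 + 1) ^ 2 *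
        (p * Matrix.trace S ^ 2 / d ^ 2) := by
  have hn1 : (1 : ℝ) ≤ n := by exact_mod_cast Nat.one_le_iff_ne_zero.2 hn
  have htr : 0 ≤ Matrix.trace S := by rw [← sum_matSqrt_sq hS]; positivity
  -- The `n` copies of `(1 / n)²` leave `1 / n`, the source of the limiting term `tr(S) / (n m)`.
  have hτ : ∑ l, ∑ t : Fin n × Fin m, (matSqrt S l t.2 / n) ^ 2 = Matrix.trace S / n := by
    rw [← sum_matSqrt_sq hS]
    simp only [Fintype.sum_prod_type, Finset.sum_const, Finset.card_univ, Fintype.card_fin,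
      nsmul_eq_mul, div_pow, ← Finset.sum_div, ← Finset.mul_sum]
    field_simp
  -- The `n` noise matrices are stacked into one array with rows indexed by `Fin n × Fin m`, so its
  -- `p` columns are independent.
  have hind : iIndepFun (fun (t : (Fin n × Fin m) × Fin p) ω => E t.1.1 ω t.1.2 t.2) P :=
    hE.indep.precomp (g := fun t : (Fin n × Fin m) × Fin p => (t.1.1, t.1.2, t.2))
      (Equiv.prodAssoc _ _ _).injective
  obtain ⟨h1, h2⟩ := lpNorm_quadratic_form_sq_le
    (X := fun (t : Fin n × Fin m) (j : Fin p) ω => E t.1 ω t.2 j) hr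
    (fun t j => hE.measurable _ _ _) hind (fun t j => hmem _ _ _) (fun t j => hE.mean _ _ _)
    (fun t j => hE.variance _ _ _) (fun t j => hκ _ _ _)
    (fun (l : Fin m) (t : Fin n × Fin m) => matSqrt S l t.2 / n)
  rw [hτ] at h1 h2
  have hfun : (fun ω => ((∑ l, ∑ j, meanNoise S (fun k => E k ω) l j ^ 2) -
      p * (Matrix.trace S / n)) / d) = (d⁻¹ • fun ω => ∑ j : Fin p,
        ((∑ l, (∑ t : Fin n × Fin m, matSqrt S l t.2 / n * E t.1 ω t.2 j) ^ 2) -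
          Matrix.trace S / n)) := by
    ext ω
    rw [Pi.smul_apply, smul_eq_mul, Finset.sum_sub_distrib, Finset.sum_comm]
    simp only [meanNoise, Matrix.of_apply, Finset.sum_const, Finset.card_univ, Fintype.card_fin,
      nsmul_eq_mul]
    ring
  rw [hfun]
  refine ⟨h1.const_smul _, ?_⟩
  rw [lpNorm_const_smul, mul_pow]
  have hd : ((‖d⁻¹‖₊ : ℝ)) ^ 2 = (d ^ 2)⁻¹ := by simp
  rw [hd]
  refine (mul_le_mul_of_nonneg_left h2 (by positivity)).trans ?_
  have hdiv : Matrix.trace S / n ≤ Matrix.trace S := div_le_self htr hn1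
  have hc1 : 0 ≤ 2 * (r / 2 + 1) ^ (r / 2) := by
    have : 0 ≤ r / 2 + 1 := by linarith
    positivity
  have hc2 : 0 ≤ 2 * (r + 1) ^ r * κ ^ 2 + 1 := by
    have : 0 ≤ r + 1 := by linarith
    positivity
  rw [Fintype.card_fin]
  calc (d ^ 2)⁻¹ * (2 * (r / 2 + 1) ^ (r / 2) *
        (p * ((2 * (r + 1) ^ r * κ ^ 2 + 1) * (Matrix.trace S / n)) ^ 2))
      ≤ (d ^ 2)⁻¹ * (2 * (r / 2 + 1) ^ (r / 2) *
        (p * ((2 * (r + 1) ^ r * κ ^ 2 + 1) * Matrix.trace S) ^ 2)) := by gcongr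
    _ = _ := by ring

end Noise

end ColumnCorrelated

/-! ### Almost sure limits of the noise terms -/

namespace ColumnCorrelated

/-- Trades the rate `1 / p` for `1 / m`: eventually `m / p ≤ 2 c`. -/
theorem eventually_div_le_div {p : ℕ → ℕ} {c : ℝ} (hc : 0 < c)
    (hp : Tendsto p atTop atTop)
    (hmp : Tendsto (fun m : ℕ => (m : ℝ) / (p m : ℝ)) atTop (𝓝 c)) {C : ℝ} (hC : 0 ≤ C) :
    ∀ᶠ m : ℕ in atTop, C / p m ≤ C * (2 * c) / m := by
  filter_upwards [hmp.eventually_le_const (show c < 2 * c by linarith), eventually_gt_atTop 0,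
    hp.eventually_gt_atTop 0] with m h hm hpm
  have hm' : (0 : ℝ) < m := Nat.cast_pos.2 hm
  have hpm' : (0 : ℝ) < p m := Nat.cast_pos.2 hpm
  rw [div_le_iff₀ hpm'] at h
  rw [div_le_div_iff₀ hpm' hm', mul_assoc]
  exact mul_le_mul_of_nonneg_left h hC

section Limits

variable {Ω : Type*} [MeasurableSpace Ω] {P : Measure Ω} [IsProbabilityMeasure P]
  {n : ℕ} {p : ℕ → ℕ} {c : ℝ} {S : (m : ℕ) → Matrix (Fin m) (Fin m) ℝ}
  {E : (m : ℕ) → Fin n → Ω → Matrix (Fin m) (Fin (p m)) ℝ} {r κ CS : ℝ}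

theorem ae_tendsto_meanNoise_mul (hn : n ≠ 0) (hc : 0 < c) (hp : Tendsto p atTop atTop)
    (hmp : Tendsto (fun m : ℕ => (m : ℝ) / (p m : ℝ)) atTop (𝓝 c))
    (hS : ∀ m, (S m).PosSemidef) (hCS : ∀ m : ℕ, Matrix.trace (S m) / (m : ℝ) ≤ CS)
    (hE : ∀ m, IsStandardNoise P (E m)) (hr : 2 < r)
    (hmem : ∀ m k i j, MemLp (fun ω => E m k ω i j) (ENNReal.ofReal r) P)
    (hκ : ∀ m k i j, lpNorm (fun ω => E m k ω i j) (ENNReal.ofReal r) P ≤ κ)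
    (M : (m : ℕ) → Matrix (Fin m) (Fin (p m)) ℝ) {CM : ℝ}
    (hCM : ∀ m : ℕ, (∑ l, ∑ j, M m l j ^ 2) / ((m : ℝ) * (p m : ℝ)) ≤ CM) :
    ∀ᵐ ω ∂P, Tendsto (fun m => (∑ l, ∑ j, meanNoise (S m) (fun k => E m k ω) l j * M m l j) /
      ((m : ℝ) * (p m : ℝ))) atTop (𝓝 0) := by
  set D := 2 * (r + 1) ^ r * κ ^ 2 with hD
  have hD0 : 0 ≤ D := by
    have : 0 ≤ r + 1 := by linarith
    positivity
  -- At `m = 0` the bounded quotients are `0 / 0 = 0`, so the bounds are nonnegative.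
  have hCS0 : 0 ≤ CS := le_trans (by simp) (hCS 0)
  have hCM0 : 0 ≤ CM := le_trans (by simp) (hCM 0)
  have hb := fun m => lpNorm_meanNoise_mul_sq_le hn (hS m) (hE m) hr (hmem m) (hκ m) (M m)
    ((m : ℝ) * (p m : ℝ))
  refine ae_tendsto_zero_of_lpNorm_sq_le (C := D * (CS * CM) * (2 * c)) hr
    (fun m => (hb m).1) ?_
  filter_upwards [eventually_div_le_div hc hp hmp (C := D * (CS * CM)) (by positivity),
    eventually_gt_atTop 0, hp.eventually_gt_atTop 0] with m h hm hpm
  have hm' : (0 : ℝ) < m := Nat.cast_pos.2 hm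
  have hpm' : (0 : ℝ) < p m := Nat.cast_pos.2 hpm
  refine ((hb m).2.trans ?_).trans h
  rw [mul_div_assoc D]
  refine mul_le_mul_of_nonneg_left ?_ hD0
  calc Matrix.trace (S m) * (∑ l, ∑ j, M m l j ^ 2) / ((m : ℝ) * (p m : ℝ)) ^ 2
      = Matrix.trace (S m) / m * ((∑ l, ∑ j, M m l j ^ 2) / ((m : ℝ) * (p m : ℝ))) / p m := by
        field_simp
    _ ≤ CS * CM / p m := by
        gcongr
        exacts [hCS m, hCM m]

theorem ae_tendsto_meanNoise_sq (hn : n ≠ 0) (hc : 0 < c) (hp : Tendsto p atTop atTop)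
    (hmp : Tendsto (fun m : ℕ => (m : ℝ) / (p m : ℝ)) atTop (𝓝 c))
    (hS : ∀ m, (S m).PosSemidef) (hCS : ∀ m : ℕ, Matrix.trace (S m) / (m : ℝ) ≤ CS)
    (hE : ∀ m, IsStandardNoise P (E m)) (hr : 4 < r)
    (hmem : ∀ m k i j, MemLp (fun ω => E m k ω i j) (ENNReal.ofReal r) P)
    (hκ : ∀ m k i j, lpNorm (fun ω => E m k ω i j) (ENNReal.ofReal r) P ≤ κ) :
    ∀ᵐ ω ∂P, Tendsto (fun m => ((∑ l, ∑ j, meanNoise (S m) (fun k => E m k ω) l j ^ 2) -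
      p m * (Matrix.trace (S m) / n)) / ((m : ℝ) * (p m : ℝ))) atTop (𝓝 0) := by
  set D := 2 * (r / 2 + 1) ^ (r / 2) * (2 * (r + 1) ^ r * κ ^ 2 + 1) ^ 2 with hD
  have hD0 : 0 ≤ D := by
    have : 0 ≤ r / 2 + 1 := by linarith
    positivity
  have hb := fun m => lpNorm_meanNoise_sq_sq_le hn (hS m) (hE m) hr (hmem m) (hκ m)
    ((m : ℝ) * (p m : ℝ))
  refine ae_tendsto_zero_of_lpNorm_sq_le (C := D * CS ^ 2 * (2 * c)) (by linarith)
    (fun m => (hb m).1) ?_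
  filter_upwards [eventually_div_le_div hc hp hmp (C := D * CS ^ 2) (by positivity),
    eventually_gt_atTop 0, hp.eventually_gt_atTop 0] with m h hm hpm
  have hm' : (0 : ℝ) < m := Nat.cast_pos.2 hm
  have hpm' : (0 : ℝ) < p m := Nat.cast_pos.2 hpm
  have htr : 0 ≤ Matrix.trace (S m) := (hS m).trace_nonneg
  refine ((hb m).2.trans ?_).trans h
  rw [mul_div_assoc D]
  refine mul_le_mul_of_nonneg_left ?_ hD0
  calc (p m : ℝ) * Matrix.trace (S m) ^ 2 / ((m : ℝ) * (p m : ℝ)) ^ 2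
      = (Matrix.trace (S m) / m) ^ 2 / p m := by
        field_simp
    _ ≤ CS ^ 2 / p m := by
        gcongr
        exact hCS m

end Limits

end ColumnCorrelated

/-! ### The three equivalents -/

theorem theorem3 {Ω : Type*} [MeasurableSpace Ω] (P : Measure Ω) [IsProbabilityMeasure P]
    -- sample size, number of columns for each number `m` of rows, limiting ratio
    (n : ℕ) (hn : 2 ≤ n) (p : ℕ → ℕ) (c : ℝ) (hc : 0 < c)
    (hp : Tendsto p atTop atTop)
    (hmp : Tendsto (fun m : ℕ => (m : ℝ) / (p m : ℝ)) atTop (𝓝 c))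
    -- the true matrices
    (A : (m : ℕ) → Matrix (Fin m) (Fin (p m)) ℝ)
    (hA_nonneg : ∀ m i j, 0 ≤ A m i j)
    (hA_bdd : ∃ C : ℝ, ∀ m : ℕ,
      Matrix.trace (A m * (A m).transpose) / ((m : ℝ) * (p m : ℝ)) ≤ C)
    -- the column covariance matrices
    (S : (m : ℕ) → Matrix (Fin m) (Fin m) ℝ)
    (hS : ∀ m, (S m).PosSemidef)
    (hS_bdd : ∃ C : ℝ, ∀ m : ℕ, Matrix.trace (S m) / (m : ℝ) ≤ C)
    -- the noise matrices, with moments of order `4 + ε` bounded uniformly in `m`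
    (E : (m : ℕ) → Fin n → Ω → Matrix (Fin m) (Fin (p m)) ℝ)
    (hE : ∀ m, ColumnCorrelated.IsStandardNoise P (E m))
    (ε : ℝ) (hε : 0 < ε)
    (hE_int : ∀ m k i j, Integrable (fun ω => |E m k ω i j| ^ (4 + ε)) P)
    (hE_bdd : ∃ K : ℝ, ∀ m k i j, ∫ ω, |E m k ω i j| ^ (4 + ε) ∂P ≤ K) :
    ColumnCorrelated.AsympDetEquiv P
      (fun m ω => Matrix.trace (ColumnCorrelated.sampleMean (A m) (S m) (fun k => E m k ω) *
        (ColumnCorrelated.allOnes m (p m)).transpose) / ((m : ℝ) * (p m : ℝ)))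
      (fun m => Matrix.trace (A m * (ColumnCorrelated.allOnes m (p m)).transpose) /
        ((m : ℝ) * (p m : ℝ))) ∧
    ColumnCorrelated.AsympDetEquiv P
      (fun m ω => Matrix.trace (ColumnCorrelated.sampleMean (A m) (S m) (fun k => E m k ω) *
        (A m).transpose) / ((m : ℝ) * (p m : ℝ)))
      (fun m => Matrix.trace (A m * (A m).transpose) / ((m : ℝ) * (p m : ℝ))) ∧
    ColumnCorrelated.AsympDetEquiv P
      (fun m ω => Matrix.trace (ColumnCorrelated.sampleMean (A m) (S m) (fun k => E m k ω) *
        (ColumnCorrelated.sampleMean (A m) (S m) (fun k => E m k ω)).transpose) /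
        ((m : ℝ) * (p m : ℝ)))
      (fun m => Matrix.trace (A m * (A m).transpose) / ((m : ℝ) * (p m : ℝ)) +
        Matrix.trace (S m) / ((n : ℝ) * (m : ℝ))) := by
  obtain ⟨CA, hCA⟩ := hA_bdd
  obtain ⟨CS, hCS⟩ := hS_bdd
  obtain ⟨K, hK⟩ := hE_bdd
  have hn0 : n ≠ 0 := by omega
  have hr : 4 < 4 + ε := by linarith
  have hr0 : 0 < 4 + ε := by linarith
  have hmem : ∀ m k i j, MemLp (fun ω => E m k ω i j) (ENNReal.ofReal (4 + ε)) P :=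
    fun m k i j => memLp_ofReal_of_integrable_abs_rpow hr0
      ((hE m).measurable k i j).aestronglyMeasurable (hE_int m k i j)
  have hκ : ∀ m k i j, lpNorm (fun ω => E m k ω i j) (ENNReal.ofReal (4 + ε)) P ≤
      K ^ (4 + ε)⁻¹ := fun m k i j => by
    have h := hK m k i j
    rw [integral_abs_rpow_eq_lpNorm hr0 (hmem m k i j).1] at h
    have h0 := Real.rpow_le_rpow (Real.rpow_nonneg lpNorm_nonneg _) h (inv_nonneg.2 hr0.le)
    rwa [Real.rpow_rpow_inv lpNorm_nonneg hr0.ne'] at h0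
  have hlin := fun (M : (m : ℕ) → Matrix (Fin m) (Fin (p m)) ℝ) (CM : ℝ) =>
    ColumnCorrelated.ae_tendsto_meanNoise_mul hn0 hc hp hmp hS hCS hE (by linarith) hmem hκ M
      (CM := CM)
  -- Used twice: for the second claim and for the cross term of the third.
  have hA := hlin A CA fun m => by
    have := hCA m
    rw [ColumnCorrelated.trace_mul_transpose_eq_sum] at this
    simpa only [sq] using this
  have hU := hlin (fun m => ColumnCorrelated.allOnes m (p m)) 1 fun m => by
    simp only [ColumnCorrelated.allOnes, Matrix.of_apply, one_pow, Finset.sum_const,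
      Finset.card_univ, Fintype.card_fin, nsmul_eq_mul, mul_one]
    exact div_self_le_one _
  have hQ := ColumnCorrelated.ae_tendsto_meanNoise_sq hn0 hc hp hmp hS hCS hE hr hmem hκ
  simp only [ColumnCorrelated.AsympDetEquiv, ColumnCorrelated.sampleMean_eq_add_meanNoise hn0,
    ColumnCorrelated.trace_mul_transpose_eq_sum]
  refine ⟨?_, ?_, ?_⟩
  · filter_upwards [hU] with ω h
    refine (tendsto_zero_iff_abs_tendsto_zero _).1 (h.congr fun m => ?_)
    simp only [Matrix.add_apply, add_mul, Finset.sum_add_distrib]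
    ring
  · filter_upwards [hA] with ω h
    refine (tendsto_zero_iff_abs_tendsto_zero _).1 (h.congr fun m => ?_)
    simp only [Matrix.add_apply, add_mul, Finset.sum_add_distrib]
    ring
  · filter_upwards [hA, hQ] with ω h1 h2
    have h3 := (h1.const_mul 2).add h2
    rw [mul_zero, add_zero] at h3
    -- The identity holds only eventually: cancelling `p` in `p * (tr S / n) / (m p)` requires `p ≠
    -- 0`.
    refine (tendsto_zero_iff_abs_tendsto_zero _).1 (h3.congr' ?_)
    filter_upwards [eventually_gt_atTop 0, hp.eventually_gt_atTop 0] with m hm hpm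
    have hm' : (m : ℝ) ≠ 0 := Nat.cast_ne_zero.2 hm.ne'
    have hpm' : (p m : ℝ) ≠ 0 := Nat.cast_ne_zero.2 hpm.ne'
    have hsq : ∀ l j, (A m + ColumnCorrelated.meanNoise (S m) fun k => E m k ω) l j *
        (A m + ColumnCorrelated.meanNoise (S m) fun k => E m k ω) l j =
        A m l j * A m l j +
          2 * (ColumnCorrelated.meanNoise (S m) (fun k => E m k ω) l j * A m l j) +
          ColumnCorrelated.meanNoise (S m) (fun k => E m k ω) l j ^ 2 := fun l j => by
      rw [Matrix.add_apply]; ring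
    simp only [hsq, Finset.sum_add_distrib, ← Finset.mul_sum]
    have hnR : (n : ℝ) ≠ 0 := Nat.cast_ne_zero.2 hn0
    field_simp
    ring
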